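/- A cloud service provider allocates identical virtual machines (VMs) of efficiency $q\in(0,1]$ to tasks arriving as a Poisson process of rate $\lambda>0$ until a horizon $T$. Task complexities are i.i.d. nonnegative random variables with cdf $F$ and density $f$, where $\{f>0\}$ is an interval on which the virtual valuation $x-\frac{1-F(x)}{f(x)}$ is increasing (non-decreasing suffices). For $0\le t<T$, an integer $N\ge 1$ and a measurable threshold curve $y:[t,T]\to[0,\infty)$, let $\hat\lambda_y(s)=\lambda\,(1-F(y(s)))$, $H_y(s)=\int_t^s\hat\lambda_y(u)\,du$ and $$\mathcal R_N(y,t)=\sum_{n=1}^{N} q\int_t^T y(s)\,\hat\lambda_y(s)\,e^{-H_y(s)}\frac{H_y(s)^{n-1}}{(n-1)!}\,ds+\kappa ,$$ where $\kappa$ is a constant not depending on $y$ (it may depend on $N$). This is the expected revenue from time $t$ on when $N$ VMs are available at time $t$ and tasks of complexity at least $y(s)$ qualify at time $s$. An optimal qualification threshold for $N$ VMs available at time $t$ is a curve $y_N$ on $[t,T]$ that maximizes $\mathcal R_N(\cdot,t)$ among all nonnegative measurable curves for which the integrals converge. The price at time $s$ is $q\,y_N(s)+S(s)$, where $S$ is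 a given function that does not depend on the number of VMs. Theorem 3. If $M\ge N\ge 1$ and $y_M$, $y_N$ are optimal qualification thresholds for $M$ and $N$ VMs available at time $t$, then $y_M(s)\le y_N(s)$, and hence $q\,y_M(s)+S(s)\le q\,y_N(s)+S(s)$, for almost every $s\in[t,T]$; if $y_M$ and $y_N$ are continuous on $[t,T]$, this holds for every $s\in[t,T]$, in particular at $s=t$. -/

import Mathlib

open MeasureTheory Set

noncomputable section

namespace CloudPricing

/-- `f` is a probability density of a nonnegative random variable (the complexity of a task). -/
structure IsTaskDensity (f : ℝ → ℝ) : Prop where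
  nonneg : ∀ x, 0 ≤ f x
  zero_of_neg : ∀ x, x < 0 → f x = 0
  integrable : Integrable f
  integral_eq_one : ∫ x, f x = 1

/-- The cumulative distribution function belonging to the density `f`. -/
def taskCDF (f : ℝ → ℝ) (x : ℝ) : ℝ := ∫ z in Iic x, f z

/-- The virtual valuation `x - (1 - F x) / f x` (meaningful where `f x > 0`). -/
def virtualValuation (f : ℝ → ℝ) (x : ℝ) : ℝ := x - (1 - taskCDF f x) / f x

/-- Intensity at time `s` of the arrivals of tasks that qualify for the threshold curve `y`, when
tasks arrive at rate `lam`. -/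
def qualRate (lam : ℝ) (f : ℝ → ℝ) (y : ℝ → ℝ) (s : ℝ) : ℝ := lam * (1 - taskCDF f (y s))

/-- Expected number of qualifying arrivals between the times `t` and `s`. -/
def cumRate (lam : ℝ) (f : ℝ → ℝ) (y : ℝ → ℝ) (t s : ℝ) : ℝ := ∫ u in t..s, qualRate lam f y u

/-- Density at `s ≥ t` of the time of the `n`-th qualifying arrival (`n ≥ 1`) after time `t`, i.e.
of the `n`-th arrival time of a Poisson process with intensity `qualRate lam f y`. -/
def waitDensity (lam : ℝ) (f : ℝ → ℝ) (y : ℝ → ℝ) (t : ℝ) (n : ℕ) (s : ℝ) : ℝ :=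
  qualRate lam f y s * Real.exp (-cumRate lam f y t s) *
    (cumRate lam f y t s ^ (n - 1) / ((n - 1).factorial : ℝ))

/-- Total expected revenue from time `t` up to the horizon `T` when `N` machines of efficiency `q`
are available at time `t` and the threshold curve `y` is used from time `t` onwards; `κ` is the
threshold-independent revenue due to the additional price. -/
def revenue (q lam : ℝ) (f : ℝ → ℝ) (T κ : ℝ) (N : ℕ) (t : ℝ) (y : ℝ → ℝ) : ℝ :=
  (∑ n ∈ Finset.Icc 1 N, q * ∫ s in t..T, y s * waitDensity lam f y t n s) + κ

/-- The threshold curves competing in the revenue maximization from time `t` on: nonnegative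
measurable curves on `[t, T]` for which the integrals in the expected revenue converge. -/
structure IsAdmissible (lam : ℝ) (f : ℝ → ℝ) (T : ℝ) (N : ℕ) (t : ℝ) (y : ℝ → ℝ) : Prop where
  nonneg : ∀ s ∈ Icc t T, 0 ≤ y s
  aemeasurable : AEMeasurable y (volume.restrict (Icc t T))
  integrable : ∀ n ∈ Finset.Icc 1 N,
    IntervalIntegrable (fun s => y s * waitDensity lam f y t n s) volume t T

/-- `y` is an optimal (revenue maximizing) qualification threshold on `[t, T]` when `N` machines are
available at time `t`. -/
def IsOptimalThreshold (q lam : ℝ) (f : ℝ → ℝ) (T κ : ℝ) (N : ℕ) (t : ℝ) (y : ℝ → ℝ) : Prop :=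
  IsAdmissible lam f T N t y ∧
    ∀ z : ℝ → ℝ, IsAdmissible lam f T N t z →
      revenue q lam f T κ N t z ≤ revenue q lam f T κ N t y

/-- Price charged at time `s` to a qualifying task: `q * y s` plus the additional price `S s`. -/
def price (q : ℝ) (S : ℝ → ℝ) (y : ℝ → ℝ) (s : ℝ) : ℝ := q * y s + S s

end CloudPricing

end

open MeasureTheory Set

noncomputable section

namespace CloudPricing

/-! ### Poisson weights and the hazard rate of the Erlang distributions -/

/-! Summing the densities of the first `n + 1 = N` arrival times turns the revenue into `q ∫ y w(y)
G_n(H) + κ`. Here `w` is the rate of qualifying tasks, `H` the expected number of qualifying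
arrivals so far, and `G_n` the Poisson distribution function. Replacing an optimal curve by a
constant on a short interval yields a maximum principle (`maximum_principle`): at almost every time
`y` maximizes `(v - c) w(v)`, where the opportunity cost `c` vanishes at `T` and satisfies `c' =
-ρ_n(H) (y - c) w(y)`. The factor `ρ_n = g_n / G_n`, with `g_n` the Poisson weight, is the Erlang
hazard rate.

Maximizers of `(v - c) w(v)` increase with `c`, so the core is that more machines mean a lower cost
(`IsExtremal.cost_le`). Suppose the cost with more machines is strictly higher on some maximal
interval. There its net revenue rate and its arrival rate are the lower ones. The gap must close
again by `T`, so somewhere on the interval its hazard rate is the larger one. Its arrivals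
accumulate more slowly, and this reversal then propagates back to the left end
(`erlangHazard_lt_of_sub_le`). At time `t` it is impossible, both counts being zero; at a later left
end it makes the gap decrease from a nonpositive value, so no gap could open.

Equal costs leave the maximizer undetermined only for countably many costs
(`countable_ambiguousCosts`), and a strictly decreasing cost takes these values on a null set of
times. -/

/-- The probability that a Poisson variable of mean `x` takes the value `n`. -/
def poissonWeight (n : ℕ) (x : ℝ) : ℝ := Real.exp (-x) * (x ^ n / (n.factorial : ℝ))

/-- The probability that a Poisson variable of mean `x` is at most `n`. -/
def poissonCDF (n : ℕ) (x : ℝ) : ℝ := ∑ k ∈ Finset.range (n + 1), poissonWeight k x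

/-- The ratio `poissonWeight n x / poissonCDF n x` for `x ≥ 0`, that is, the hazard rate of the
`(n + 1)`-st arrival time of a Poisson process of rate one, defined recursively. -/
def erlangHazard : ℕ → ℝ → ℝ
  | 0, _ => 1
  | n + 1, x => x * erlangHazard n x / (x * erlangHazard n x + (n + 1))

lemma erlangHazard_zero (x : ℝ) : erlangHazard 0 x = 1 := rfl

lemma erlangHazard_succ (n : ℕ) (x : ℝ) :
    erlangHazard (n + 1) x = x * erlangHazard n x / (x * erlangHazard n x + (n + 1)) := rfl

lemma poissonWeight_nonneg (n : ℕ) {x : ℝ} (hx : 0 ≤ x) : 0 ≤ poissonWeight n x := by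
  unfold poissonWeight; positivity

lemma poissonCDF_pos (n : ℕ) {x : ℝ} (hx : 0 ≤ x) : 0 < poissonCDF n x := by
  unfold poissonCDF
  rw [Finset.sum_range_succ']
  have h0 : 0 < poissonWeight 0 x := by unfold poissonWeight; positivity
  have h1 : 0 ≤ ∑ k ∈ Finset.range n, poissonWeight (k + 1) x :=
    Finset.sum_nonneg fun k _ => poissonWeight_nonneg _ hx
  linarith

lemma poissonWeight_succ (n : ℕ) (x : ℝ) :
    poissonWeight (n + 1) x = poissonWeight n x * x / (n + 1) := by
  unfold poissonWeight
  rw [Nat.factorial_succ]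
  push_cast
  field_simp
  ring

lemma contDiff_poissonWeight (n : ℕ) : ContDiff ℝ 1 (poissonWeight n) := by
  unfold poissonWeight; fun_prop

lemma contDiff_poissonCDF (n : ℕ) : ContDiff ℝ 1 (poissonCDF n) := by
  unfold poissonCDF
  exact ContDiff.sum fun k _ => contDiff_poissonWeight k

lemma continuous_poissonWeight (n : ℕ) : Continuous (poissonWeight n) :=
  (contDiff_poissonWeight n).continuous

lemma continuous_poissonCDF (n : ℕ) : Continuous (poissonCDF n) :=
  (contDiff_poissonCDF n).continuous

lemma hasDerivAt_poissonWeight_succ (n : ℕ) (x : ℝ) :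
    HasDerivAt (poissonWeight (n + 1)) (poissonWeight n x - poissonWeight (n + 1) x) x := by
  have h1 : HasDerivAt (fun x : ℝ => Real.exp (-x)) (-Real.exp (-x)) x := by
    simpa using (hasDerivAt_neg x).exp
  have h2 : HasDerivAt (fun x : ℝ => x ^ (n + 1) / ((n + 1).factorial : ℝ))
      (((n + 1 : ℕ) : ℝ) * x ^ n / ((n + 1).factorial : ℝ)) x := by
    simpa using (hasDerivAt_pow (n + 1) x).div_const ((n + 1).factorial : ℝ)
  refine (h1.mul h2).congr_deriv ?_
  simp only [poissonWeight, Nat.factorial_succ]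
  push_cast
  field_simp
  ring

lemma hasDerivAt_poissonCDF (n : ℕ) (x : ℝ) :
    HasDerivAt (poissonCDF n) (-poissonWeight n x) x := by
  induction n with
  | zero =>
    have h1 : HasDerivAt (fun x : ℝ => Real.exp (-x)) (-Real.exp (-x)) x := by
      simpa using (hasDerivAt_neg x).exp
    have e : poissonCDF 0 = fun x => Real.exp (-x) := by
      funext x; simp [poissonCDF, poissonWeight]
    rw [e]
    simpa [poissonWeight] using h1
  | succ n ih =>
    have h := ih.add (hasDerivAt_poissonWeight_succ n x)
    have e : poissonCDF (n + 1) = poissonCDF n + poissonWeight (n + 1) := by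
      funext x; simp [poissonCDF, Finset.sum_range_succ _ (n + 1)]
    rw [e]
    exact h.congr_deriv (by ring)

lemma erlangHazard_nonneg (n : ℕ) {x : ℝ} (hx : 0 ≤ x) : 0 ≤ erlangHazard n x := by
  induction n with
  | zero => simp [erlangHazard_zero]
  | succ n ih => rw [erlangHazard_succ]; positivity

lemma erlangHazard_pos (n : ℕ) {x : ℝ} (hx : 0 < x) : 0 < erlangHazard n x := by
  induction n with
  | zero => simp [erlangHazard_zero]
  | succ n ih => rw [erlangHazard_succ]; positivity

lemma erlangHazard_le_one (n : ℕ) {x : ℝ} (hx : 0 ≤ x) : erlangHazard n x ≤ 1 := by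
  cases n with
  | zero => simp [erlangHazard_zero]
  | succ n =>
    have := erlangHazard_nonneg n hx
    rw [erlangHazard_succ, div_le_one (by positivity)]
    have : (0 : ℝ) ≤ n := n.cast_nonneg
    linarith

/-- The recursion comes from `g_{n+1} = g_n x / (n + 1)` and `G_{n+1} = G_n + g_{n+1}`, after
division by `G_n`. It lets comparisons of hazard rates go by induction on the number of phases. -/
lemma erlangHazard_mul_poissonCDF (n : ℕ) {x : ℝ} (hx : 0 ≤ x) :
    erlangHazard n x * poissonCDF n x = poissonWeight n x := by
  induction n with
  | zero => simp [erlangHazard_zero, poissonCDF]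
  | succ n ih =>
    have := erlangHazard_nonneg n hx
    have e : poissonCDF (n + 1) x = poissonCDF n x + poissonWeight (n + 1) x := by
      simp [poissonCDF, Finset.sum_range_succ _ (n + 1)]
    have hpos : 0 < x * erlangHazard n x + (n + 1) := by positivity
    rw [e, erlangHazard_succ, poissonWeight_succ, ← ih]
    field_simp
    ring

lemma continuousOn_erlangHazard (n : ℕ) : ContinuousOn (erlangHazard n) (Ici 0) := by
  induction n with
  | zero => exact continuousOn_const
  | succ n ih =>
    have h : ContinuousOn (fun x => x * erlangHazard n x) (Ici 0) := continuousOn_id.mul ih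
    refine h.div (h.add continuousOn_const) fun x hx => ?_
    have := erlangHazard_nonneg n (mem_Ici.1 hx)
    have : 0 ≤ x := hx
    positivity

lemma hasDerivAt_erlangHazard (n : ℕ) {x : ℝ} (hx : 0 < x) :
    HasDerivAt (erlangHazard n) (erlangHazard n x * (n / x - 1 + erlangHazard n x)) x := by
  induction n with
  | zero =>
    have e : erlangHazard 0 = fun _ => (1 : ℝ) := rfl
    rw [e]
    simpa using hasDerivAt_const x (1 : ℝ)
  | succ n ih =>
    have hρ := erlangHazard_pos n hx
    have hpos : x * erlangHazard n x + (n + 1) ≠ 0 := by positivity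
    have h := (hasDerivAt_id x).mul ih
    have h' := h.div (h.add_const ((n : ℝ) + 1)) hpos
    refine h'.congr_deriv ?_
    simp only [erlangHazard_succ, Pi.mul_apply, id]
    push_cast
    field_simp
    ring

/-- The Erlang hazard rate increases in time and decreases in the number of phases. -/
lemma erlangHazard_mono {n m : ℕ} (hnm : n ≤ m) {X x : ℝ} (hX : 0 ≤ X) (hXx : X ≤ x) :
    erlangHazard m X ≤ erlangHazard n x := by
  induction n generalizing m with
  | zero => exact erlangHazard_le_one m hX
  | succ n ih =>
    obtain ⟨m, rfl⟩ : ∃ k, m = k + 1 := ⟨m - 1, by omega⟩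
    have hx := hX.trans hXx
    have h := ih (m := m) (by omega)
    have h1 := erlangHazard_nonneg m hX
    have h2 := erlangHazard_nonneg n hx
    have hnm' : (n : ℝ) ≤ m := by exact_mod_cast (by omega : n ≤ m)
    have hn : (0 : ℝ) ≤ n := n.cast_nonneg
    have hm : (0 : ℝ) ≤ m := m.cast_nonneg
    rw [erlangHazard_succ, erlangHazard_succ, div_le_div_iff₀ (by positivity) (by positivity)]
    have h3 : X * erlangHazard m X ≤ x * erlangHazard n x := mul_le_mul hXx h h1 hx
    have h4 : X * erlangHazard m X * (n + 1) ≤ x * erlangHazard n x * (m + 1) :=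
      mul_le_mul h3 (by linarith) (by positivity) (by positivity)
    nlinarith

/-- By the recursion `1 / ρ_{n+1}(x) = 1 + (n + 1) / (x ρ_n(x))`, the claim reduces to one phase
less. The hypothesis descends because `x < X`. -/
lemma erlangHazard_lt_of_mul_lt {n m : ℕ} {X x : ℝ} (hx : 0 < x) (hxX : x < X)
    (h : n * X < m * x) : erlangHazard m X < erlangHazard n x := by
  induction n generalizing m with
  | zero =>
    obtain ⟨m, rfl⟩ : ∃ k, m = k + 1 := by
      refine ⟨m - 1, ?_⟩
      rcases Nat.eq_zero_or_pos m with rfl | hm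
      · simp at h
      · omega
    have hX := hx.trans hxX
    have := erlangHazard_pos m hX
    rw [erlangHazard_zero, erlangHazard_succ, div_lt_one (by positivity)]
    have : (0 : ℝ) ≤ m := m.cast_nonneg
    linarith
  | succ n ih =>
    have hX := hx.trans hxX
    obtain ⟨m, rfl⟩ : ∃ k, m = k + 1 := by
      refine ⟨m - 1, ?_⟩
      rcases Nat.eq_zero_or_pos m with rfl | hm
      · have : 0 < ((n + 1 : ℕ) : ℝ) * X := by positivity
        simp at h; push_cast at this; linarith
      · omega
    push_cast at h
    have h0 := ih (m := m) (by nlinarith)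
    have h1 := erlangHazard_pos m hX
    have h2 := erlangHazard_pos n hx
    rw [erlangHazard_succ, erlangHazard_succ, div_lt_div_iff₀ (by positivity) (by positivity)]
    have h4 : erlangHazard m X * ((n + 1) * X) < erlangHazard n x * ((m + 1) * x) :=
      mul_lt_mul h0 h.le (by positivity) h2.le
    nlinarith

/-- This orders the slopes where two hazard curves meet: at equal values `ρ (n / x - 1 + ρ)` depends
only on `n / x`. Otherwise, peeling off one phase makes the weak reverse inequality strict, and the
hazards could not agree. -/
lemma div_lt_div_of_erlangHazard_eq {n m : ℕ} (hn : n ≠ 0) {X x : ℝ} (hx : 0 < x) (hxX : x < X)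
    (h : erlangHazard m X = erlangHazard n x) : m / X < n / x := by
  by_contra! hcon
  have hX := hx.trans hxX
  rw [div_le_div_iff₀ hx hX] at hcon
  obtain ⟨n, rfl⟩ : ∃ k, n = k + 1 := ⟨n - 1, by omega⟩
  obtain ⟨m, rfl⟩ : ∃ k, m = k + 1 := by
    refine ⟨m - 1, ?_⟩
    rcases Nat.eq_zero_or_pos m with rfl | hm
    · have : 0 < ((n + 1 : ℕ) : ℝ) * X := by positivity
      simp at hcon; push_cast at this; linarith
    · omega
  push_cast at hcon
  have h0 := erlangHazard_lt_of_mul_lt (n := n) (m := m) hx hxX (by nlinarith)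
  have h1 := erlangHazard_pos m hX
  have h2 := erlangHazard_pos n hx
  have h5 : erlangHazard (m + 1) X < erlangHazard (n + 1) x := by
    rw [erlangHazard_succ, erlangHazard_succ, div_lt_div_iff₀ (by positivity) (by positivity)]
    have h4 : erlangHazard m X * ((n + 1) * X) < erlangHazard n x * ((m + 1) * x) :=
      mul_lt_mul h0 hcon (by positivity) h2.le
    nlinarith
  exact h5.ne h

/-- Going back in time at a slower pace preserves that the hazard rate with more phases is the
larger one. -/
lemma erlangHazard_lt_of_sub_le {n m : ℕ} (hnm : n ≤ m) {x x' X X' : ℝ} (hx' : 0 ≤ x')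
    (hxx : x' ≤ x) (hX' : 0 ≤ X') (hXX : X' ≤ X) (hsub : X - X' ≤ x - x')
    (h : erlangHazard n x < erlangHazard m X) : erlangHazard n x' < erlangHazard m X' := by
  have hX : 0 ≤ X := hX'.trans hXX
  have hn : n ≠ 0 := by
    rintro rfl
    exact absurd (erlangHazard_le_one m hX) (by simpa [erlangHazard_zero] using h)
  have hxX : x < X := by
    by_contra! hcon
    exact absurd (erlangHazard_mono hnm hX hcon) h.not_ge
  set δ := X - x with hδ
  have hδ0 : 0 < δ := by simp [hδ, hxX]
  -- The slower pace gives `x' + δ ≤ X'`, so monotonicity in time reduces to equal pace.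
  suffices hs : erlangHazard n x' < erlangHazard m (x' + δ) from
    hs.trans_le (erlangHazard_mono le_rfl (by linarith) (by linarith))
  by_contra! hcon
  have hx'0 : 0 < x' := by
    rcases hx'.eq_or_lt with h0 | h0
    · obtain ⟨n, rfl⟩ : ∃ k, n = k + 1 := ⟨n - 1, by omega⟩
      have := erlangHazard_pos m (x := x' + δ) (by linarith)
      rw [← h0, erlangHazard_succ] at hcon
      rw [← h0] at this
      simp only [zero_mul, zero_div] at hcon
      linarith
    · exact h0
  have hshift : ∀ u, 0 < u → HasDerivAt (fun u => erlangHazard m (u + δ))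
      (erlangHazard m (u + δ) * (m / (u + δ) - 1 + erlangHazard m (u + δ))) u := fun u hu =>
    (hasDerivAt_erlangHazard m (by linarith : 0 < u + δ)).comp_add_const u δ
  -- At every meeting point the shifted `m`-curve has the strictly smaller slope, so once below the
  -- `n`-curve it stays below up to `x`, against the hypothesis.
  have key := image_le_of_deriv_right_lt_deriv_boundary' (a := x') (b := x)
    (fun u hu => (hshift u (by linarith [hu.1])).continuousAt.continuousWithinAt)
    (fun u hu => (hshift u (by linarith [hu.1])).hasDerivWithinAt) hcon
    (fun u hu => (hasDerivAt_erlangHazard n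
      (by linarith [hu.1] : 0 < u)).continuousAt.continuousWithinAt)
    (fun u hu => (hasDerivAt_erlangHazard n (by linarith [hu.1] : 0 < u)).hasDerivWithinAt)
    (fun u hu he => by
      have hu0 : 0 < u := by linarith [hu.1]
      have h1 := div_lt_div_of_erlangHazard_eq hn hu0 (by linarith) he
      have h2 := erlangHazard_pos n hu0
      rw [he]
      exact mul_lt_mul_of_pos_left (by linarith) h2)
  have := key (right_mem_Icc.2 hxx)
  rw [hδ, add_sub_cancel] at this
  exact absurd this h.not_ge

/-! ### Extremal threshold curves and their comparison -/

/-- The first order conditions for a threshold curve `y` on `[t, T]` when `n + 1` machines are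
available: `w v` is the arrival rate of the tasks qualifying for the threshold `v`, `H` is the
expected number of qualifying arrivals, `c` is the opportunity cost of assigning a machine, and
`y` maximizes the net revenue rate at almost every time. -/
structure IsExtremal (w : ℝ → ℝ) (t T : ℝ) (n : ℕ) (y c H : ℝ → ℝ) : Prop where
  threshold_nonneg : ∀ s ∈ Icc t T, 0 ≤ y s
  rate_integrable : IntervalIntegrable (fun u => w (y u)) volume t T
  cum_eq : ∀ s, H s = ∫ u in t..s, w (y u)
  cost_continuousOn : ContinuousOn c (Icc t T)
  cost_horizon : c T = 0
  cost_integrable :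
    IntervalIntegrable (fun u => erlangHazard n (H u) * ((y u - c u) * w (y u))) volume t T
  cost_sub : ∀ s ∈ Icc t T, ∀ s' ∈ Icc t T,
    c s - c s' = ∫ u in s..s', erlangHazard n (H u) * ((y u - c u) * w (y u))
  maximal : ∀ᵐ u, u ∈ Icc t T → ∀ v, 0 ≤ v → (v - c u) * w v ≤ (y u - c u) * w (y u)
  cost_nonneg : ∀ s ∈ Icc t T, 0 ≤ c s
  exists_profitable : ∀ s ∈ Icc t T, ∃ v, c s < v ∧ 0 < w v

/-- Adding the two optimality inequalities leaves `(c₂ - c₁) (w y₂ - w y₁) ≤ 0`. -/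
lemma rate_le_of_cost_lt {w : ℝ → ℝ} {c₁ c₂ y₁ y₂ : ℝ} (hc : c₁ < c₂)
    (h₁ : (y₂ - c₁) * w y₂ ≤ (y₁ - c₁) * w y₁) (h₂ : (y₁ - c₂) * w y₁ ≤ (y₂ - c₂) * w y₂) :
    w y₂ ≤ w y₁ := by
  by_contra! h
  nlinarith

/-- Thresholds maximizing the net revenue rate are monotone in the cost. -/
lemma threshold_le_of_cost_lt {w : ℝ → ℝ} (hw : Antitone w) {c₁ c₂ y₁ y₂ : ℝ} (hc : c₁ < c₂)
    (h₁ : (y₂ - c₁) * w y₂ ≤ (y₁ - c₁) * w y₁) (h₂ : (y₁ - c₂) * w y₁ ≤ (y₂ - c₂) * w y₂)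
    (hpos : 0 < w y₁) : y₁ ≤ y₂ := by
  by_contra! h
  have he : w y₁ = w y₂ := le_antisymm (hw h.le) (rate_le_of_cost_lt hc h₁ h₂)
  rw [← he] at h₁ h₂
  have := le_of_mul_le_mul_right h₂ hpos
  linarith

/-- The endpoints are the nearest points around `s₀` where `e ≤ 0`, which compactness provides; on
the left there may be none, and then `a = t`. -/
lemma exists_Ioo_pos {e : ℝ → ℝ} {t T s₀ : ℝ} (he : ContinuousOn e (Icc t T))
    (hs₀ : s₀ ∈ Icc t T) (hpos : 0 < e s₀) (hT : e T ≤ 0) :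
    ∃ a b, t ≤ a ∧ a ≤ s₀ ∧ s₀ < b ∧ b ≤ T ∧ e b ≤ 0 ∧ (a = t ∨ (a < s₀ ∧ e a ≤ 0)) ∧
      ∀ s ∈ Ioo a b, 0 < e s := by
  have hcl : ∀ p q, t ≤ p → q ≤ T → IsCompact (Icc p q ∩ e ⁻¹' Iic 0) := fun p q hp hq =>
    isCompact_Icc.of_isClosed_subset ((he.mono (Icc_subset_Icc hp hq)).preimage_isClosed_of_isClosed
      isClosed_Icc isClosed_Iic) inter_subset_left
  obtain ⟨b, ⟨hb, hb0⟩, hbmin⟩ :=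
    (hcl s₀ T hs₀.1 le_rfl).exists_isLeast ⟨T, ⟨hs₀.2, le_rfl⟩, hT⟩
  have hb0' : e b ≤ 0 := hb0
  have hsb : s₀ < b := by
    rcases hb.1.eq_or_lt with h | h
    · rw [← h] at hb0'; linarith
    · exact h
  have hright : ∀ s, s₀ ≤ s → s < b → 0 < e s := fun s h1 h2 => by
    by_contra! h
    exact absurd (hbmin ⟨⟨h1, h2.le.trans hb.2⟩, h⟩) h2.not_ge
  rcases (Icc t s₀ ∩ e ⁻¹' Iic 0).eq_empty_or_nonempty with hemp | hne
  · refine ⟨t, b, le_rfl, hs₀.1, hsb, hb.2, hb0', Or.inl rfl, fun s hs => ?_⟩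
    rcases le_total s₀ s with h | h
    · exact hright s h hs.2
    · by_contra! hcon
      exact hemp.subset (⟨⟨hs.1.le, h⟩, hcon⟩ : s ∈ Icc t s₀ ∩ e ⁻¹' Iic 0)
  · obtain ⟨a, ⟨ha, ha0⟩, hamax⟩ := (hcl t s₀ le_rfl hs₀.2).exists_isGreatest hne
    have ha0' : e a ≤ 0 := ha0
    have has : a < s₀ := by
      rcases ha.2.eq_or_lt with h | h
      · rw [h] at ha0'; linarith
      · exact h
    refine ⟨a, b, ha.1, ha.2, hsb, hb.2, hb0', Or.inr ⟨has, ha0'⟩, fun s hs => ?_⟩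
    rcases le_total s₀ s with h | h
    · exact hright s h hs.2
    · by_contra! hcon
      exact absurd (hamax ⟨⟨ha.1.trans hs.1.le, h⟩, hcon⟩) hs.1.not_ge

lemma intervalIntegral_pos_of_ae_pos {g : ℝ → ℝ} {a b : ℝ} (hab : a < b)
    (hg : IntervalIntegrable g volume a b) (hpos : ∀ᵐ u, u ∈ Icc a b → 0 < g u) :
    0 < ∫ u in a..b, g u := by
  have h0 : ∀ᵐ u ∂(volume.restrict (Ioc a b)), 0 < g u := by
    rw [ae_restrict_iff' measurableSet_Ioc]
    filter_upwards [hpos] with u hu h using hu (Ioc_subset_Icc_self h)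
  refine lt_of_le_of_ne ?_ fun h => ?_
  · rw [intervalIntegral.integral_of_le hab.le]
    exact integral_nonneg_of_ae (h0.mono fun u hu => hu.le)
  · rw [eq_comm, intervalIntegral.integral_eq_zero_iff_of_le_of_nonneg_ae hab.le
      (h0.mono fun u hu => hu.le) hg] at h
    have hF : ∀ᵐ u ∂(volume.restrict (Ioc a b)), False := by
      filter_upwards [h0, h] with u h1 h2
      rw [h2] at h1
      exact lt_irrefl _ h1
    have := ae_iff.1 hF
    simp [hab.not_ge] at this

/-! ### Consequences of the first order conditions and comparison of costs -/

namespace IsExtremal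

variable {w : ℝ → ℝ} {t T : ℝ} {n : ℕ} {y c H : ℝ → ℝ}

lemma rate_integrable_of_mem (h : IsExtremal w t T n y c H) {a b : ℝ} (ha : a ∈ Icc t T)
    (hb : b ∈ Icc t T) : IntervalIntegrable (fun u => w (y u)) volume a b :=
  h.rate_integrable.mono_set <| by
    rw [uIcc_of_le (ha.1.trans ha.2)]; exact uIcc_subset_Icc ha hb

lemma cost_integrable_of_mem (h : IsExtremal w t T n y c H) {a b : ℝ} (ha : a ∈ Icc t T)
    (hb : b ∈ Icc t T) :
    IntervalIntegrable (fun u => erlangHazard n (H u) * ((y u - c u) * w (y u))) volume a b :=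
  h.cost_integrable.mono_set <| by
    rw [uIcc_of_le (ha.1.trans ha.2)]; exact uIcc_subset_Icc ha hb

lemma cum_sub (h : IsExtremal w t T n y c H) {a b : ℝ} (ha : a ∈ Icc t T) (hb : b ∈ Icc t T) :
    H b - H a = ∫ u in a..b, w (y u) := by
  have ht : t ∈ Icc t T := ⟨le_rfl, ha.1.trans ha.2⟩
  rw [h.cum_eq, h.cum_eq, intervalIntegral.integral_interval_sub_left
    (h.rate_integrable_of_mem ht hb) (h.rate_integrable_of_mem ht ha)]

lemma cum_start (h : IsExtremal w t T n y c H) : H t = 0 := by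
  rw [h.cum_eq, intervalIntegral.integral_same]

lemma cum_mono (h : IsExtremal w t T n y c H) (hw : ∀ v, 0 ≤ w v) {a b : ℝ} (ha : a ∈ Icc t T)
    (hb : b ∈ Icc t T) (hab : a ≤ b) : H a ≤ H b := by
  have := intervalIntegral.integral_nonneg (μ := volume) hab (fun u _ => hw (y u))
  rw [← h.cum_sub ha hb] at this
  linarith

lemma cum_nonneg (h : IsExtremal w t T n y c H) (hw : ∀ v, 0 ≤ w v) {s : ℝ} (hs : s ∈ Icc t T) :
    0 ≤ H s :=
  h.cum_start ▸ h.cum_mono hw ⟨le_rfl, hs.1.trans hs.2⟩ hs hs.1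

lemma cum_continuousOn (h : IsExtremal w t T n y c H) (htT : t ≤ T) :
    ContinuousOn H (Icc t T) := by
  have h1 := intervalIntegral.continuousOn_primitive_interval' h.rate_integrable left_mem_uIcc
  rw [uIcc_of_le htT] at h1
  exact h1.congr fun s _ => h.cum_eq s

lemma hazard_continuousOn (h : IsExtremal w t T n y c H) (hw : ∀ v, 0 ≤ w v) (htT : t ≤ T) :
    ContinuousOn (fun s => erlangHazard n (H s)) (Icc t T) :=
  (continuousOn_erlangHazard n).comp (h.cum_continuousOn htT) fun _ hs => h.cum_nonneg hw hs

/-- Almost everywhere, the net revenue rate is positive. -/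
lemma profit_pos (h : IsExtremal w t T n y c H) :
    ∀ᵐ u, u ∈ Icc t T → 0 < (y u - c u) * w (y u) := by
  filter_upwards [h.maximal] with u hu hut
  obtain ⟨v, hv, hwv⟩ := h.exists_profitable u hut
  exact (mul_pos (sub_pos.2 hv) hwv).trans_le (hu hut v ((h.cost_nonneg u hut).trans hv.le))

lemma rate_pos (h : IsExtremal w t T n y c H) (hw : ∀ v, 0 ≤ w v) :
    ∀ᵐ u, u ∈ Icc t T → 0 < w (y u) := by
  filter_upwards [h.profit_pos] with u hu hut
  refine lt_of_le_of_ne (hw _) fun h0 => ?_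
  have := hu hut
  rw [← h0, mul_zero] at this
  exact lt_irrefl _ this

lemma cum_pos (h : IsExtremal w t T n y c H) (hw : ∀ v, 0 ≤ w v) {s : ℝ} (hts : t < s)
    (hsT : s ≤ T) : 0 < H s := by
  have ht : t ∈ Icc t T := ⟨le_rfl, hts.le.trans hsT⟩
  have hs : s ∈ Icc t T := ⟨hts.le, hsT⟩
  rw [h.cum_eq]
  refine intervalIntegral_pos_of_ae_pos hts (h.rate_integrable_of_mem ht hs) ?_
  filter_upwards [h.rate_pos hw] with u hu hus using hu ⟨hus.1, hus.2.trans hsT⟩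

lemma cost_lt (h : IsExtremal w t T n y c H) (hw : ∀ v, 0 ≤ w v) {a b : ℝ} (ha : a ∈ Icc t T)
    (hb : b ∈ Icc t T) (hab : a < b) : c b < c a := by
  rw [← sub_pos, h.cost_sub a ha b hb]
  refine intervalIntegral_pos_of_ae_pos hab (h.cost_integrable_of_mem ha hb) ?_
  -- The time `t` is discarded because the hazard rate may vanish there: `H t = 0`.
  filter_upwards [h.profit_pos, Measure.ae_ne volume t] with u hu hut hus
  have huT : u ≤ T := hus.2.trans hb.2
  have htu : t ≤ u := ha.1.trans hus.1
  exact mul_pos (erlangHazard_pos n (h.cum_pos hw (lt_of_le_of_ne htu hut.symm) huT))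
    (hu ⟨htu, huT⟩)

lemma cost_injOn (h : IsExtremal w t T n y c H) (hw : ∀ v, 0 ≤ w v) : InjOn c (Icc t T) := by
  intro a ha b hb he
  rcases lt_trichotomy a b with hab | hab | hab
  · exact absurd he (h.cost_lt hw ha hb hab).ne'
  · exact hab
  · exact absurd he (h.cost_lt hw hb ha hab).ne

/-- With more machines the opportunity cost is lower at all times. -/
theorem cost_le {m : ℕ} {y' c' H' : ℝ → ℝ} {B : ℝ} (h : IsExtremal w t T n y c H)
    (h' : IsExtremal w t T m y' c' H') (hnm : n ≤ m) (hw : ∀ v, 0 ≤ w v) (hB : ∀ v, w v ≤ B)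
    (htT : t ≤ T) {s : ℝ} (hs : s ∈ Icc t T) : c' s ≤ c s := by
  by_contra! hcon
  have hec : ContinuousOn (fun s => c' s - c s) (Icc t T) :=
    h'.cost_continuousOn.sub h.cost_continuousOn
  obtain ⟨a, b, hta, has, hsb, hbT, heb, hea, hpos⟩ := exists_Ioo_pos hec hs (sub_pos.2 hcon)
    (by rw [h'.cost_horizon, h.cost_horizon, sub_zero])
  have hab : a < b := has.trans_lt hsb
  have ha : a ∈ Icc t T := ⟨hta, hab.le.trans hbT⟩
  have hb : b ∈ Icc t T := ⟨hta.trans hab.le, hbT⟩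
  have hsubset : ∀ u ∈ Ioo a b, u ∈ Icc t T := fun u hu => ⟨hta.trans hu.1.le, hu.2.le.trans hbT⟩
  -- a representation of the increments of `c' - c`
  have hincr : ∀ p ∈ Icc t T, ∀ q ∈ Icc t T, (c' q - c q) - (c' p - c p) =
      ∫ u in p..q, (erlangHazard n (H u) * ((y u - c u) * w (y u)) -
        erlangHazard m (H' u) * ((y' u - c' u) * w (y' u))) := by
    intro p hp q hq
    rw [intervalIntegral.integral_sub (h.cost_integrable_of_mem hp hq)
      (h'.cost_integrable_of_mem hp hq), ← h.cost_sub p hp q hq, ← h'.cost_sub p hp q hq]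
    ring
  have hprofit : ∀ᵐ u, u ∈ Ioo a b →
      0 < (y' u - c' u) * w (y' u) ∧ (y' u - c' u) * w (y' u) ≤ (y u - c u) * w (y u) := by
    filter_upwards [h.maximal, h'.profit_pos] with u h1 h2 hu
    have hut := hsubset u hu
    refine ⟨h2 hut, le_trans ?_ (h1 hut (y' u) (h'.threshold_nonneg u hut))⟩
    exact mul_le_mul_of_nonneg_right (by linarith [hpos u hu]) (hw _)
  have hrate : ∀ᵐ u, u ∈ Ioo a b → w (y' u) ≤ w (y u) := by
    filter_upwards [h.maximal, h'.maximal] with u h1 h2 hu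
    have hut := hsubset u hu
    exact rate_le_of_cost_lt (sub_pos.1 (hpos u hu)) (h1 hut _ (h'.threshold_nonneg u hut))
      (h2 hut _ (h.threshold_nonneg u hut))
  -- the hazard rates are reversed somewhere
  obtain ⟨r, hr, hhaz⟩ : ∃ r ∈ Ioo a b, erlangHazard n (H r) < erlangHazard m (H' r) := by
    -- Otherwise `c' - c` would be nondecreasing from `s` to `b`, but it is positive at `s` and
    -- nonpositive at `b`.
    by_contra! hle
    have h0 : 0 ≤ (c' b - c b) - (c' s - c s) := by
      rw [hincr s hs b hb, intervalIntegral.integral_of_le hsb.le]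
      refine setIntegral_nonneg_of_ae_restrict ?_
      rw [Filter.EventuallyLE, ae_restrict_iff' measurableSet_Ioc]
      filter_upwards [hprofit, Measure.ae_ne volume b] with u hu hub hus
      have huab : u ∈ Ioo a b := ⟨has.trans_lt hus.1, lt_of_le_of_ne hus.2 hub⟩
      obtain ⟨h1, h2⟩ := hu huab
      exact sub_nonneg.2 (mul_le_mul (hle u huab) h2 h1.le
        (erlangHazard_nonneg _ (h.cum_nonneg hw (hsubset u huab))))
    linarith
  -- hence at all earlier times of the interval
  have hrt : r ∈ Icc t T := hsubset r hr
  have hhaza : erlangHazard n (H a) < erlangHazard m (H' a) := by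
    refine erlangHazard_lt_of_sub_le hnm (h.cum_nonneg hw ha) (h.cum_mono hw ha hrt hr.1.le)
      (h'.cum_nonneg hw ha) (h'.cum_mono hw ha hrt hr.1.le) ?_ hhaz
    rw [h.cum_sub ha hrt, h'.cum_sub ha hrt]
    refine intervalIntegral.integral_mono_ae_restrict hr.1.le (h'.rate_integrable_of_mem ha hrt)
      (h.rate_integrable_of_mem ha hrt) ?_
    rw [Filter.EventuallyLE, ae_restrict_iff' measurableSet_Icc]
    filter_upwards [hrate, Measure.ae_ne volume a] with u hu hua hus
    exact hu ⟨lt_of_le_of_ne hus.1 hua.symm, hus.2.trans_lt hr.2⟩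
  rcases hea with rfl | ⟨has', hea⟩
  · rw [h.cum_start, h'.cum_start] at hhaza
    exact absurd (erlangHazard_mono hnm le_rfl le_rfl) hhaza.not_ge
  -- so that `c' - c` cannot become positive
  obtain ⟨v, hv, hwv⟩ := h'.exists_profitable a ha
  have hv0 : 0 ≤ v := (h'.cost_nonneg a ha).trans hv.le
  have hB0 : 0 ≤ B := (hw 0).trans (hB 0)
  -- `Φ` is a continuous upper bound, near `a`, for the derivative of `c' - c`, which itself
  -- involves the merely measurable thresholds. It results from two estimates: the net revenue rates
  -- differ by at most `B (c' - c)`, and the one for `c'` is at least that of the fixed profitable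
  -- `v`, multiplied by a negative difference of hazards.
  set Φ : ℝ → ℝ := fun u => (erlangHazard n (H u) - erlangHazard m (H' u)) * ((v - c' u) * w v) +
    B * (c' u - c u) * erlangHazard n (H u) with hΦ
  have hΦc : ContinuousOn Φ (Icc t T) :=
    (((h.hazard_continuousOn hw htT).sub (h'.hazard_continuousOn hw htT)).mul
      ((continuousOn_const.sub h'.cost_continuousOn).mul continuousOn_const)).add
      ((continuousOn_const.mul hec).mul (h.hazard_continuousOn hw htT))
  have hΦa : Φ a < 0 := by
    have h1 : (erlangHazard n (H a) - erlangHazard m (H' a)) * ((v - c' a) * w v) < 0 :=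
      mul_neg_of_neg_of_pos (by linarith) (mul_pos (by linarith) hwv)
    have h2 : B * (c' a - c a) * erlangHazard n (H a) ≤ 0 :=
      mul_nonpos_of_nonpos_of_nonneg (mul_nonpos_of_nonneg_of_nonpos hB0 hea)
        (erlangHazard_nonneg _ (h.cum_nonneg hw ha))
    simp only [hΦ]
    linarith
  have hev : ∀ᶠ u in nhdsWithin a (Icc t T),
      Φ u < 0 ∧ erlangHazard n (H u) < erlangHazard m (H' u) :=
    ((hΦc a ha).eventually_lt continuousWithinAt_const hΦa).and
      ((h.hazard_continuousOn hw htT a ha).eventually_lt (h'.hazard_continuousOn hw htT a ha) hhaza)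
  obtain ⟨ε, hε, hball⟩ := Metric.mem_nhdsWithin_iff.1 hev
  set p := min (a + ε / 2) ((a + b) / 2) with hp
  have hap : a < p := lt_min (by linarith) (by linarith)
  have hpb : p < b := (min_le_right _ _).trans_lt (by linarith)
  have hpε : p < a + ε := (min_le_left _ _).trans_lt (by linarith)
  have hle : (c' p - c p) - (c' a - c a) ≤ 0 := by
    rw [hincr a ha p (hsubset p ⟨hap, hpb⟩), intervalIntegral.integral_of_le hap.le]
    refine setIntegral_nonpos_of_ae_restrict ?_
    rw [Filter.EventuallyLE, ae_restrict_iff' measurableSet_Ioc]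
    filter_upwards [hprofit, h'.maximal] with u h1 h2 hu
    have huab : u ∈ Ioo a b := ⟨hu.1, hu.2.trans_lt hpb⟩
    have hut := hsubset u huab
    obtain ⟨hΦu, hhazu⟩ := hball ⟨by
      rw [Metric.mem_ball, Real.dist_eq, abs_of_pos (sub_pos.2 hu.1)]
      linarith [hu.2], hut⟩
    have hmu := h2 hut (y u) (h.threshold_nonneg u hut)
    have hmv := h2 hut v hv0
    have he := hpos u huab
    have hρ := erlangHazard_nonneg n (h.cum_nonneg hw hut)
    have hdiff : (y u - c u) * w (y u) ≤ (y' u - c' u) * w (y' u) + B * (c' u - c u) := by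
      have := mul_le_mul_of_nonneg_right (hB (y u)) he.le
      linarith
    have h3 := mul_le_mul_of_nonneg_left hdiff hρ
    have h4 := mul_le_mul_of_nonneg_left hmv (sub_nonneg.2 hhazu.le)
    simp only [hΦ] at hΦu
    simp only [Pi.zero_apply]
    nlinarith
  have := hpos p ⟨hap, hpb⟩
  linarith

end IsExtremal

/-- The costs admitting several thresholds of maximal net revenue rate. -/
def ambiguousCosts (w : ℝ → ℝ) : Set ℝ :=
  {c | ∃ p : ℝ × ℝ, p.1 < p.2 ∧
    (0 ≤ p.1 ∧ 0 < w p.1 ∧ ∀ v, 0 ≤ v → (v - c) * w v ≤ (p.1 - c) * w p.1) ∧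
    0 ≤ p.2 ∧ 0 < w p.2 ∧ ∀ v, 0 ≤ v → (v - c) * w v ≤ (p.2 - c) * w p.2}

/-- The open intervals between two maximizers are disjoint for different costs, since maximizers are
monotone in the cost; the line holds only countably many such intervals. -/
lemma countable_ambiguousCosts {w : ℝ → ℝ} (hw : Antitone w) : (ambiguousCosts w).Countable := by
  choose! p hlt h₁ h₂ using fun c (hc : c ∈ ambiguousCosts w) => hc
  have key : ∀ c ∈ ambiguousCosts w, ∀ c' ∈ ambiguousCosts w, c < c' →
      Disjoint (Ioo (p c).1 (p c).2) (Ioo (p c').1 (p c').2) := by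
    intro c hc c' hc' hcc
    obtain ⟨ha, hb, hm⟩ := h₂ c hc
    obtain ⟨ha', hb', hm'⟩ := h₁ c' hc'
    have := threshold_le_of_cost_lt hw hcc (hm _ ha') (hm' _ ha) hb
    rw [Set.disjoint_left]
    intro x hx hx'
    linarith [hx.2, hx'.1]
  refine PairwiseDisjoint.countable_of_isOpen (s := fun c => Ioo (p c).1 (p c).2) ?_
    (fun _ _ => isOpen_Ioo) (fun c hc => nonempty_Ioo.2 (hlt c hc))
  intro c hc c' hc' hne
  rcases hne.lt_or_gt with h | h
  · exact key c hc c' hc' h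
  · exact (key c' hc' c hc h).symm

/-- With more machines the threshold is lower at almost all times. -/
theorem IsExtremal.threshold_le {w : ℝ → ℝ} {t T B : ℝ} {n m : ℕ} {y c H y' c' H' : ℝ → ℝ}
    (h : IsExtremal w t T n y c H) (h' : IsExtremal w t T m y' c' H') (hnm : n ≤ m)
    (hw : ∀ v, 0 ≤ w v) (hB : ∀ v, w v ≤ B) (hanti : Antitone w) (htT : t ≤ T) :
    ∀ᵐ s, s ∈ Icc t T → y' s ≤ y s := by
  have hcount : (Icc t T ∩ c ⁻¹' ambiguousCosts w).Countable :=
    MapsTo.countable_of_injOn (f := c) (fun _ hs => hs.2)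
      ((h.cost_injOn hw).mono inter_subset_left) (countable_ambiguousCosts hanti)
  filter_upwards [h.maximal, h'.maximal, h.rate_pos hw, h'.rate_pos hw, hcount.ae_notMem volume]
    with s h1 h2 h3 h4 h5 hs
  have hy := h.threshold_nonneg s hs
  have hy' := h'.threshold_nonneg s hs
  rcases (h.cost_le h' hnm hw hB htT hs).lt_or_eq with hlt | heq
  · exact threshold_le_of_cost_lt hanti hlt (h2 hs _ hy) (h1 hs _ hy') (h4 hs)
  · by_contra! hcon
    -- At equal costs both thresholds are maximizers, so strict inequality would make this cost
    -- ambiguous.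
    refine h5 ⟨hs, (y s, y' s), hcon, ⟨hy, h3 hs, h1 hs⟩, hy', h4 hs, ?_⟩
    rw [← heq]
    exact h2 hs

/-! ### The control problem of choosing a threshold curve -/

/-- `w v` is the arrival rate of tasks qualifying for the threshold `v`. -/
structure IsDemand (w : ℝ → ℝ) (B : ℝ) : Prop where
  antitone : Antitone w
  nonneg : ∀ v, 0 ≤ w v
  le : ∀ v, w v ≤ B
  exists_pos : ∃ v, 0 < v ∧ 0 < w v

/-- The expected number of qualifying arrivals between the times `t` and `s`. -/
def cumDemand (w : ℝ → ℝ) (t : ℝ) (y : ℝ → ℝ) (s : ℝ) : ℝ := ∫ u in t..s, w (y u)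

/-- The threshold curves with a well-defined expected revenue. -/
structure IsFeasible (w : ℝ → ℝ) (t T : ℝ) (y : ℝ → ℝ) : Prop where
  nonneg : ∀ s ∈ Icc t T, 0 ≤ y s
  aemeasurable : AEMeasurable y (volume.restrict (Icc t T))
  integrable : IntervalIntegrable (fun s => y s * w (y s)) volume t T

/-- The expected revenue of the threshold curve `y` from `n + 1` machines, per unit of
efficiency. -/
def payoff (w : ℝ → ℝ) (t T : ℝ) (n : ℕ) (y : ℝ → ℝ) : ℝ :=
  ∫ s in t..T, y s * w (y s) * poissonCDF n (cumDemand w t y s)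

/-- The marginal loss of expected revenue after the time `s` caused by additional arrivals. -/
def marginalLoss (w : ℝ → ℝ) (t T : ℝ) (n : ℕ) (y : ℝ → ℝ) (s : ℝ) : ℝ :=
  ∫ u in s..T, y u * w (y u) * poissonWeight n (cumDemand w t y u)

/-- The opportunity cost of assigning a machine at the time `s`. -/
def opportunityCost (w : ℝ → ℝ) (t T : ℝ) (n : ℕ) (y : ℝ → ℝ) (s : ℝ) : ℝ :=
  marginalLoss w t T n y s / poissonCDF n (cumDemand w t y s)

lemma intervalIntegrable_demand {w : ℝ → ℝ} {B t T : ℝ} (hw : IsDemand w B) (htT : t ≤ T)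
    {y : ℝ → ℝ} (hy : AEMeasurable y (volume.restrict (Icc t T))) :
    IntervalIntegrable (fun u => w (y u)) volume t T := by
  rw [intervalIntegrable_iff_integrableOn_Icc_of_le htT]
  refine Integrable.mono' (g := fun _ => B) (integrable_const B)
    (hw.antitone.measurable.comp_aemeasurable hy).aestronglyMeasurable
    (Filter.Eventually.of_forall fun u => ?_)
  rw [Real.norm_eq_abs, abs_of_nonneg (hw.nonneg _)]
  exact hw.le _

lemma mem_of_mem_uIcc {t T a b : ℝ} (ha : a ∈ Icc t T) (hb : b ∈ Icc t T) :
    uIcc a b ⊆ uIcc t T := by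
  rw [uIcc_of_le (ha.1.trans ha.2)]; exact uIcc_subset_Icc ha hb

/-! ### Regularity and integrability along a feasible curve -/

namespace IsFeasible

variable {w : ℝ → ℝ} {B t T : ℝ} {y : ℝ → ℝ}

lemma demand_integrable (hy : IsFeasible w t T y) (hw : IsDemand w B) (htT : t ≤ T) {a b : ℝ}
    (ha : a ∈ Icc t T) (hb : b ∈ Icc t T) : IntervalIntegrable (fun u => w (y u)) volume a b :=
  (intervalIntegrable_demand hw htT hy.aemeasurable).mono_set (mem_of_mem_uIcc ha hb)

lemma cum_sub (hy : IsFeasible w t T y) (hw : IsDemand w B) {a b : ℝ}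
    (ha : a ∈ Icc t T) (hb : b ∈ Icc t T) :
    cumDemand w t y b - cumDemand w t y a = ∫ u in a..b, w (y u) := by
  have htT := ha.1.trans ha.2
  have ht : t ∈ Icc t T := left_mem_Icc.2 htT
  unfold cumDemand
  rw [intervalIntegral.integral_interval_sub_left
    (hy.demand_integrable hw htT ht hb) (hy.demand_integrable hw htT ht ha)]

lemma cum_mem (hw : IsDemand w B) {s : ℝ} (hs : s ∈ Icc t T) :
    cumDemand w t y s ∈ Icc 0 (B * (T - t)) := by
  have hB : 0 ≤ B := (hw.nonneg 0).trans (hw.le 0)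
  refine ⟨intervalIntegral.integral_nonneg hs.1 fun u _ => hw.nonneg _, ?_⟩
  have h := intervalIntegral.norm_integral_le_of_norm_le_const (a := t) (b := s) (C := B)
    (f := fun u => w (y u)) fun u _ => by
      rw [Real.norm_eq_abs, abs_of_nonneg (hw.nonneg _)]; exact hw.le _
  rw [abs_of_nonneg (sub_nonneg.2 hs.1)] at h
  exact (le_abs_self _).trans (h.trans (mul_le_mul_of_nonneg_left (by linarith [hs.2]) hB))

lemma cum_lipschitz (hy : IsFeasible w t T y) (hw : IsDemand w B) :
    LipschitzOnWith B.toNNReal (cumDemand w t y) (Icc t T) := by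
  have hB : 0 ≤ B := (hw.nonneg 0).trans (hw.le 0)
  refine LipschitzOnWith.of_dist_le_mul fun a ha b hb => ?_
  rw [Real.dist_eq, hy.cum_sub hw hb ha, Real.coe_toNNReal _ hB, Real.dist_eq]
  exact intervalIntegral.norm_integral_le_of_norm_le_const (f := fun u => w (y u)) fun u _ => by
      rw [Real.norm_eq_abs, abs_of_nonneg (hw.nonneg _)]; exact hw.le _

lemma cum_continuousOn (hy : IsFeasible w t T y) (hw : IsDemand w B) :
    ContinuousOn (cumDemand w t y) (Icc t T) := (hy.cum_lipschitz hw).continuousOn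

lemma comp_cum_continuousOn (hy : IsFeasible w t T y) (hw : IsDemand w B) {g : ℝ → ℝ}
    (hg : ContinuousOn g (Ici 0)) : ContinuousOn (fun s => g (cumDemand w t y s)) (Icc t T) :=
  hg.comp (hy.cum_continuousOn hw) fun _ hs => (cum_mem hw hs).1

lemma mul_integrable (hy : IsFeasible w t T y) {g : ℝ → ℝ} (hg : ContinuousOn g (Icc t T))
    {a b : ℝ} (ha : a ∈ Icc t T) (hb : b ∈ Icc t T) :
    IntervalIntegrable (fun s => y s * w (y s) * g s) volume a b := by
  have hsub := mem_of_mem_uIcc ha hb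
  refine (hy.integrable.mono_set hsub).mul_continuousOn (hg.mono ?_)
  rwa [← uIcc_of_le (ha.1.trans ha.2)]

lemma weight_integrable (hy : IsFeasible w t T y) (hw : IsDemand w B) (n : ℕ)
    {a b : ℝ} (ha : a ∈ Icc t T) (hb : b ∈ Icc t T) :
    IntervalIntegrable (fun s => y s * w (y s) * poissonWeight n (cumDemand w t y s)) volume a b :=
  hy.mul_integrable (hy.comp_cum_continuousOn hw (continuous_poissonWeight n).continuousOn) ha hb

lemma cdf_integrable (hy : IsFeasible w t T y) (hw : IsDemand w B) (n : ℕ)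
    {a b : ℝ} (ha : a ∈ Icc t T) (hb : b ∈ Icc t T) :
    IntervalIntegrable (fun s => y s * w (y s) * poissonCDF n (cumDemand w t y s)) volume a b :=
  hy.mul_integrable (hy.comp_cum_continuousOn hw (continuous_poissonCDF n).continuousOn) ha hb

/-- Using the constant threshold `v` in a time interval keeps a curve feasible. -/
lemma ite (hy : IsFeasible w t T y) {a b v : ℝ} (hv : 0 ≤ v) :
    IsFeasible w t T (fun s => if s ∈ Ioc a b then v else y s) := by
  classical
  refine ⟨fun s hs => ?_, ?_, ?_⟩
  · split_ifs
    exacts [hv, hy.nonneg s hs]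
  · refine ⟨fun s => if s ∈ Ioc a b then v else hy.aemeasurable.mk y s,
      Measurable.ite measurableSet_Ioc measurable_const hy.aemeasurable.measurable_mk, ?_⟩
    filter_upwards [hy.aemeasurable.ae_eq_mk] with s hs
    rw [hs]
  · have h : IntervalIntegrable (fun s => v * w v) volume t T := by simp
    have e : (fun s => (if s ∈ Ioc a b then v else y s) * w (if s ∈ Ioc a b then v else y s)) =
        (Ioc a b).piecewise (fun _ => v * w v) (fun s => y s * w (y s)) := by
      funext s
      by_cases hs : s ∈ Ioc a b <;> simp [hs]
    rw [e]
    exact ⟨Integrable.piecewise measurableSet_Ioc h.1.integrableOn hy.integrable.1.integrableOn,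
      Integrable.piecewise measurableSet_Ioc h.2.integrableOn hy.integrable.2.integrableOn⟩

end IsFeasible

/-- A second order lower bound for the Poisson distribution function. -/
lemma exists_poissonCDF_sub_ge (n : ℕ) (R : ℝ) : ∃ L, 0 ≤ L ∧ ∀ x ∈ Icc 0 R, ∀ x' ∈ Icc 0 R,
    -(poissonWeight n x * (x' - x)) - L * (x' - x) ^ 2 ≤ poissonCDF n x' - poissonCDF n x := by
  obtain ⟨L, hL⟩ := (contDiff_poissonWeight n).contDiffOn.exists_lipschitzOnWith (by decide)
    (convex_Icc 0 R) isCompact_Icc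
  refine ⟨L, L.2, fun x hx x' hx' => ?_⟩
  have hsub : uIcc x x' ⊆ Icc 0 R := uIcc_subset_Icc hx hx'
  -- Mean value inequality for `G_n` minus its tangent at `x`, whose derivative is at most `L |x' -
  -- x|` by the Lipschitz bound.
  have h := (convex_uIcc x x').norm_image_sub_le_of_norm_hasDerivWithin_le
    (f := fun u => poissonCDF n u + poissonWeight n x * u)
    (f' := fun u => -poissonWeight n u + poissonWeight n x) (C := L * |x' - x|)
    (fun u _ => by
      have h2 := (hasDerivAt_poissonCDF n u).add ((hasDerivAt_id u).const_mul (poissonWeight n x))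
      rw [mul_one] at h2
      exact h2.hasDerivWithinAt)
    (fun u hu => by
      have h1 := hL.dist_le_mul x hx u (hsub hu)
      rw [Real.dist_eq, Real.dist_eq] at h1
      rw [Real.norm_eq_abs, neg_add_eq_sub]
      refine h1.trans (mul_le_mul_of_nonneg_left ?_ L.2)
      rw [abs_sub_comm]
      exact abs_sub_left_of_mem_uIcc hu) left_mem_uIcc right_mem_uIcc
  rw [Real.norm_eq_abs, Real.norm_eq_abs, mul_assoc, ← abs_mul, ← sq,
    abs_of_nonneg (sq_nonneg (x' - x)), abs_le] at h
  nlinarith [h.1]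

lemma nonpos_of_hasDerivAt_of_right_nonpos {g : ℝ → ℝ} {d a b : ℝ} (hg : HasDerivAt g d a)
    (hab : a < b) (ha : g a = 0) (h : ∀ r ∈ Ioo a b, g r ≤ 0) : d ≤ 0 := by
  have ht := (hasDerivWithinAt_iff_tendsto_slope' (s := Ioi a) (by simp)).1 hg.hasDerivWithinAt
  refine le_of_tendsto ht ?_
  filter_upwards [Ioo_mem_nhdsGT hab] with r hr
  rw [slope_def_field, ha, sub_zero]
  exact div_nonpos_of_nonpos_of_nonneg (h r hr) (by linarith [hr.1])

/-! ### Needle variations and the maximum principle -/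

namespace IsFeasible

variable {w : ℝ → ℝ} {B t T : ℝ} {y : ℝ → ℝ}

/-- The first order effect of using the constant threshold `v` from the time `a` to the time `r`. -/
lemma payoff_ite_sub_ge (hy : IsFeasible w t T y) (hw : IsDemand w B) (n : ℕ) :
    ∃ L, ∀ a r v, t ≤ a → a ≤ r → r ≤ T → 0 ≤ v →
      (∫ u in a..r, v * w v * poissonCDF n (cumDemand w t y a + (u - a) * w v)) -
        (∫ u in a..r, y u * w (y u) * poissonCDF n (cumDemand w t y u)) -
        ((r - a) * w v - (cumDemand w t y r - cumDemand w t y a)) * marginalLoss w t T n y r -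
        L * ((r - a) * w v - (cumDemand w t y r - cumDemand w t y a)) ^ 2 ≤
      payoff w t T n (fun s => if s ∈ Ioc a r then v else y s) - payoff w t T n y := by
  obtain ⟨L, hL0, hL⟩ := exists_poissonCDF_sub_ge n (B * (T - t))
  -- The constant is uniform in `a`, `r`, `v` because all cumulative counts stay in `[0, B (T -
  -- t)]`.
  refine ⟨L * ∫ u in t..T, y u * w (y u), fun a r v hta har hrT hv => ?_⟩
  set z : ℝ → ℝ := fun s => if s ∈ Ioc a r then v else y s with hz
  have hzf : IsFeasible w t T z := hy.ite hv
  have ht : t ∈ Icc t T := ⟨le_rfl, hta.trans (har.trans hrT)⟩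
  have hT : T ∈ Icc t T := ⟨ht.2, le_rfl⟩
  have ha : a ∈ Icc t T := ⟨hta, har.trans hrT⟩
  have hr : r ∈ Icc t T := ⟨hta.trans har, hrT⟩
  -- The surplus of arrivals due to the variation: the count is unchanged before `a` and shifted by
  -- the constant `δ` after `r`.
  set δ := (r - a) * w v - (cumDemand w t y r - cumDemand w t y a) with hδ
  have hz1 : ∀ u ∈ Icc t a, cumDemand w t z u = cumDemand w t y u := by
    intro u hu
    refine intervalIntegral.integral_congr fun x hx => ?_
    rw [uIcc_of_le hu.1] at hx
    have : x ∉ Ioc a r := fun h => absurd (h.1.trans_le hx.2) hu.2.not_gt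
    simp only [hz, this, if_false]
  have hz2 : ∀ u ∈ Icc a r, cumDemand w t z u = cumDemand w t y a + (u - a) * w v := by
    intro u hu
    have huT : u ∈ Icc t T := ⟨hta.trans hu.1, hu.2.trans hrT⟩
    have h1 := hzf.cum_sub hw ha huT
    rw [hz1 a ⟨hta, le_rfl⟩] at h1
    have h2 : ∫ x in a..u, w (z x) = ∫ x in a..u, w v := by
      refine intervalIntegral.integral_congr_ae (Filter.Eventually.of_forall fun x hx => ?_)
      rw [uIoc_of_le hu.1] at hx
      have : x ∈ Ioc a r := ⟨hx.1, hx.2.trans hu.2⟩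
      simp only [hz, this, if_true]
    rw [h2, intervalIntegral.integral_const, smul_eq_mul] at h1
    linarith
  have hz3 : ∀ u ∈ Icc r T, cumDemand w t z u = cumDemand w t y u + δ := by
    intro u hu
    have huT : u ∈ Icc t T := ⟨hr.1.trans hu.1, hu.2⟩
    have h1 := hzf.cum_sub hw hr huT
    have h2 := hy.cum_sub hw hr huT
    have h3 : ∫ x in r..u, w (z x) = ∫ x in r..u, w (y x) := by
      refine intervalIntegral.integral_congr_ae (Filter.Eventually.of_forall fun x hx => ?_)
      rw [uIoc_of_le hu.1] at hx
      have : x ∉ Ioc a r := fun h => absurd hx.1 h.2.not_gt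
      simp only [hz, this, if_false]
    rw [hz2 r ⟨har, le_rfl⟩, h3, ← h2] at h1
    rw [hδ]
    linarith
  have split : ∀ x : ℝ → ℝ, IsFeasible w t T x → payoff w t T n x =
      (∫ u in t..a, x u * w (x u) * poissonCDF n (cumDemand w t x u)) +
      (∫ u in a..r, x u * w (x u) * poissonCDF n (cumDemand w t x u)) +
      ∫ u in r..T, x u * w (x u) * poissonCDF n (cumDemand w t x u) := by
    intro x hx
    rw [intervalIntegral.integral_add_adjacent_intervals (hx.cdf_integrable hw n ht ha)
      (hx.cdf_integrable hw n ha hr), intervalIntegral.integral_add_adjacent_intervals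
      (hx.cdf_integrable hw n ht hr) (hx.cdf_integrable hw n hr hT), payoff]
  have e1 : ∫ u in t..a, z u * w (z u) * poissonCDF n (cumDemand w t z u) =
      ∫ u in t..a, y u * w (y u) * poissonCDF n (cumDemand w t y u) := by
    refine intervalIntegral.integral_congr fun x hx => ?_
    rw [uIcc_of_le hta] at hx
    have : x ∉ Ioc a r := fun h => absurd h.1 hx.2.not_gt
    simp only [hz1 x hx]
    simp only [hz, this, if_false]
  have e2 : ∫ u in a..r, z u * w (z u) * poissonCDF n (cumDemand w t z u) =
      ∫ u in a..r, v * w v * poissonCDF n (cumDemand w t y a + (u - a) * w v) := by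
    refine intervalIntegral.integral_congr_ae (Filter.Eventually.of_forall fun x hx => ?_)
    rw [uIoc_of_le har] at hx
    simp only [hz2 x (Ioc_subset_Icc_self hx)]
    simp only [hz, hx, if_true]
  have e3 : ∀ x ∈ Ioc r T, z x * w (z x) = y x * w (y x) := by
    intro x hx
    have : x ∉ Ioc a r := fun h => absurd hx.1 h.2.not_gt
    simp only [hz, this, if_false]
  have hk : ∀ x ∈ Icc t T, 0 ≤ y x * w (y x) := fun x hx =>
    mul_nonneg (hy.nonneg x hx) (hw.nonneg _)
  have hkint : IntervalIntegrable (fun x => y x * w (y x)) volume r T :=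
    hy.integrable.mono_set (mem_of_mem_uIcc hr hT)
  have e4 : -(δ * marginalLoss w t T n y r) - L * δ ^ 2 * ∫ u in r..T, y u * w (y u) ≤
      (∫ u in r..T, z u * w (z u) * poissonCDF n (cumDemand w t z u)) -
        ∫ u in r..T, y u * w (y u) * poissonCDF n (cumDemand w t y u) := by
    rw [marginalLoss, ← intervalIntegral.integral_const_mul, ← intervalIntegral.integral_neg,
      ← intervalIntegral.integral_const_mul, ← intervalIntegral.integral_sub,
      ← intervalIntegral.integral_sub (hzf.cdf_integrable hw n hr hT)
        (hy.cdf_integrable hw n hr hT)]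
    · refine intervalIntegral.integral_mono_on_of_le_Ioo hrT ?_ ?_ fun x hx => ?_
      · exact ((hy.weight_integrable hw n hr hT).const_mul δ).neg.sub (hkint.const_mul _)
      · exact (hzf.cdf_integrable hw n hr hT).sub (hy.cdf_integrable hw n hr hT)
      · have hxT : x ∈ Icc t T := ⟨hr.1.trans hx.1.le, hx.2.le⟩
        have h1 := hL _ (cum_mem (y := y) hw hxT) _ (cum_mem (y := z) hw hxT)
        rw [hz3 x (Ioo_subset_Icc_self hx), add_sub_cancel_left] at h1
        rw [e3 x ⟨hx.1, hx.2.le⟩, hz3 x (Ioo_subset_Icc_self hx)]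
        have h2 := mul_le_mul_of_nonneg_left h1 (hk x hxT)
        linarith
    · exact ((hy.weight_integrable hw n hr hT).const_mul δ).neg
    · exact hkint.const_mul _
  have e5 : ∫ u in r..T, y u * w (y u) ≤ ∫ u in t..T, y u * w (y u) := by
    refine intervalIntegral.integral_mono_interval hr.1 hrT le_rfl ?_ hy.integrable
    rw [Filter.EventuallyLE, ae_restrict_iff' measurableSet_Ioc]
    exact Filter.Eventually.of_forall fun x hx => hk x (Ioc_subset_Icc_self hx)
  have e6 := mul_le_mul_of_nonneg_left e5 (mul_nonneg hL0 (sq_nonneg δ))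
  rw [split z hzf, split y hy, e1, e2]
  linarith

/-- The maximum principle. -/
theorem maximum_principle (hy : IsFeasible w t T y) (hw : IsDemand w B) (n : ℕ)
    (hopt : ∀ z, IsFeasible w t T z → payoff w t T n z ≤ payoff w t T n y) :
    ∀ᵐ s, s ∈ Icc t T → ∀ v, 0 ≤ v →
      (v - opportunityCost w t T n y s) * w v ≤ (y s - opportunityCost w t T n y s) * w (y s) := by
  rcases lt_or_ge T t with htT | htT
  · simp [Icc_eq_empty htT.not_ge]
  have ht : t ∈ Icc t T := left_mem_Icc.2 htT
  have hT : T ∈ Icc t T := right_mem_Icc.2 htT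
  have hdH := (hy.demand_integrable hw htT ht hT).ae_hasDerivAt_integral
  have hdP := (hy.weight_integrable hw n ht hT).ae_hasDerivAt_integral
  have hdF := (hy.cdf_integrable hw n ht hT).ae_hasDerivAt_integral
  rw [uIcc_of_le htT] at hdH hdP hdF
  obtain ⟨L, hL⟩ := hy.payoff_ite_sub_ge hw n
  -- The exceptional null set is fixed before `v`, so it serves all `v` at once. The horizon is
  -- excluded since the variation needs room to the right of `s`.
  filter_upwards [hdH, hdP, hdF, Measure.ae_ne volume T] with s h1 h2 h3 hsT hs v hv
  replace h1 : HasDerivAt (cumDemand w t y) (w (y s)) s := h1 hs t ht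
  replace h2 := (h2 hs T hT).neg
  have e2 : (-fun x => ∫ u in T..x, y u * w (y u) * poissonWeight n (cumDemand w t y u)) =
      marginalLoss w t T n y := by
    funext x
    rw [marginalLoss, intervalIntegral.integral_symm]
    rfl
  rw [e2] at h2
  replace h3 := h3 hs s hs
  have h4 : HasDerivAt (fun r => ∫ u in s..r, v * w v *
      poissonCDF n (cumDemand w t y s + (u - s) * w v))
      (v * w v * poissonCDF n (cumDemand w t y s + (s - s) * w v)) s := by
    have hc : Continuous fun u =>
        v * w v * poissonCDF n (cumDemand w t y s + (u - s) * w v) :=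
      continuous_const.mul ((continuous_poissonCDF n).comp (by fun_prop))
    exact intervalIntegral.integral_hasDerivAt_right (hc.intervalIntegrable _ _)
      (hc.stronglyMeasurableAtFilter _ _) hc.continuousAt
  have h5 : HasDerivAt (fun r => (r - s) * w v - (cumDemand w t y r - cumDemand w t y s))
      (1 * w v - w (y s)) s :=
    (((hasDerivAt_id s).sub_const s).mul_const (w v)).sub (h1.sub_const _)
  -- The lower bound for the gain vanishes at `r = s` and is nonpositive for `r > s` by optimality,
  -- so its derivative is nonpositive. The quadratic term contributes nothing.
  have h6 := (((h4.sub h3).sub (h5.mul h2)).sub ((h5.pow 2).const_mul L))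
  have h7 := nonpos_of_hasDerivAt_of_right_nonpos h6 (lt_of_le_of_ne hs.2 hsT) (by simp)
    (fun r hr => (hL s r v hs.1 hr.1.le hr.2.le hv).trans
      (sub_nonpos.2 (hopt _ (hy.ite hv))))
  simp only [sub_self, zero_mul, add_zero, one_mul] at h7
  have hG := poissonCDF_pos n (cum_mem (y := y) hw hs).1
  have hP : marginalLoss w t T n y s =
      opportunityCost w t T n y s * poissonCDF n (cumDemand w t y s) := by
    rw [opportunityCost, div_mul_cancel₀ _ hG.ne']
  rw [hP] at h7
  refine le_of_mul_le_mul_right ?_ hG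
  norm_num at h7
  linarith

end IsFeasible

/-! ### The differential equation of the opportunity cost -/

namespace IsFeasible

variable {w : ℝ → ℝ} {B t T : ℝ} {y : ℝ → ℝ}

lemma ae_hasDerivAt_cumDemand (hy : IsFeasible w t T y) (hw : IsDemand w B) (htT : t ≤ T) :
    ∀ᵐ s, s ∈ Icc t T → HasDerivAt (cumDemand w t y) (w (y s)) s := by
  have h := (hy.demand_integrable hw htT (left_mem_Icc.2 htT)
    (right_mem_Icc.2 htT)).ae_hasDerivAt_integral
  rw [uIcc_of_le htT] at h
  filter_upwards [h] with s hs hsT using hs hsT t (left_mem_Icc.2 htT)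

/-- For a merely measurable `y`, the count is only Lipschitz; absolute continuity is what recovers
increments from almost everywhere derivatives. -/
lemma absolutelyContinuous_comp_cum (hy : IsFeasible w t T y) (hw : IsDemand w B) (htT : t ≤ T)
    {g : ℝ → ℝ} (hg : ∀ R, ContDiffOn ℝ 1 g (Icc 0 R)) :
    AbsolutelyContinuousOnInterval (fun s => g (cumDemand w t y s)) t T := by
  obtain ⟨L, hL⟩ := (hg (B * (T - t))).exists_lipschitzOnWith (by decide) (convex_Icc _ _)
    isCompact_Icc
  refine LipschitzOnWith.absolutelyContinuousOnInterval (K := L * B.toNNReal) ?_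
  rw [uIcc_of_le htT]
  exact hL.comp (hy.cum_lipschitz hw) fun _ hs => cum_mem hw hs

lemma marginalLoss_eq_neg (n : ℕ) : marginalLoss w t T n y =
    fun s => -∫ u in T..s, y u * w (y u) * poissonWeight n (cumDemand w t y u) := by
  funext s
  rw [marginalLoss, intervalIntegral.integral_symm]

lemma ae_hasDerivAt_marginalLoss (hy : IsFeasible w t T y) (hw : IsDemand w B) (htT : t ≤ T)
    (n : ℕ) : ∀ᵐ s, s ∈ Icc t T → HasDerivAt (marginalLoss w t T n y)
      (-(y s * w (y s) * poissonWeight n (cumDemand w t y s))) s := by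
  have h := (hy.weight_integrable hw n (left_mem_Icc.2 htT)
    (right_mem_Icc.2 htT)).ae_hasDerivAt_integral
  rw [uIcc_of_le htT] at h
  filter_upwards [h] with s hs hsT
  rw [marginalLoss_eq_neg]
  exact (hs hsT T (right_mem_Icc.2 htT)).neg

lemma opportunityCost_eq_mul (n : ℕ) : opportunityCost w t T n y =
    fun s => marginalLoss w t T n y s * (poissonCDF n (cumDemand w t y s))⁻¹ := by
  funext s
  rw [opportunityCost, div_eq_mul_inv]

lemma opportunityCost_absolutelyContinuous (hy : IsFeasible w t T y) (hw : IsDemand w B)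
    (htT : t ≤ T) (n : ℕ) : AbsolutelyContinuousOnInterval (opportunityCost w t T n y) t T := by
  have h1 : AbsolutelyContinuousOnInterval (marginalLoss w t T n y) t T := by
    rw [marginalLoss_eq_neg]
    exact ((hy.weight_integrable hw n (left_mem_Icc.2 htT)
      (right_mem_Icc.2 htT)).absolutelyContinuousOnInterval_intervalIntegral right_mem_uIcc).neg
  have h2 := hy.absolutelyContinuous_comp_cum hw htT (g := fun x => (poissonCDF n x)⁻¹)
    fun R => (contDiff_poissonCDF n).contDiffOn.inv fun x hx => (poissonCDF_pos n hx.1).ne'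
  rw [opportunityCost_eq_mul]
  exact h1.mul h2

lemma opportunityCost_continuousOn (hy : IsFeasible w t T y) (hw : IsDemand w B)
    (htT : t ≤ T) (n : ℕ) : ContinuousOn (opportunityCost w t T n y) (Icc t T) := by
  have := (hy.opportunityCost_absolutelyContinuous hw htT n).continuousOn
  rwa [uIcc_of_le htT] at this

/-- Quotient rule with numerator derivative `-y w(y) g_n(H)` and denominator derivative `-g_n(H)
w(y)`, then `g_n = ρ_n G_n`. -/
lemma ae_deriv_opportunityCost (hy : IsFeasible w t T y) (hw : IsDemand w B) (htT : t ≤ T)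
    (n : ℕ) : ∀ᵐ s, s ∈ Icc t T → deriv (opportunityCost w t T n y) s =
      -(erlangHazard n (cumDemand w t y s) * ((y s - opportunityCost w t T n y s) * w (y s))) := by
  filter_upwards [hy.ae_hasDerivAt_marginalLoss hw htT n, hy.ae_hasDerivAt_cumDemand hw htT]
    with s h1 h2 hs
  have hH := (cum_mem (y := y) hw hs).1
  have hG := poissonCDF_pos n hH
  have h3 := (h1 hs).div ((hasDerivAt_poissonCDF n _).comp s (h2 hs)) hG.ne'
  have h4 : HasDerivAt (opportunityCost w t T n y) _ s := h3
  rw [h4.deriv, ← erlangHazard_mul_poissonCDF n hH, opportunityCost]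
  simp only [Function.comp_apply]
  field_simp
  ring

lemma net_integrable (hy : IsFeasible w t T y) (hw : IsDemand w B) (htT : t ≤ T) (n : ℕ) :
    IntervalIntegrable (fun s => erlangHazard n (cumDemand w t y s) *
      ((y s - opportunityCost w t T n y s) * w (y s))) volume t T := by
  have h1 := hy.comp_cum_continuousOn hw (continuousOn_erlangHazard n)
  have h2 := (h1.mul (hy.opportunityCost_continuousOn hw htT n))
  have h3 := hy.mul_integrable h1 (left_mem_Icc.2 htT) (right_mem_Icc.2 htT)
  rw [← uIcc_of_le htT] at h2
  have h4 := (hy.demand_integrable hw htT (left_mem_Icc.2 htT)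
    (right_mem_Icc.2 htT)).mul_continuousOn h2
  refine (h3.sub h4).congr fun s _ => ?_
  simp only [Pi.mul_apply]
  ring

lemma opportunityCost_sub (hy : IsFeasible w t T y) (hw : IsDemand w B) (n : ℕ) {a b : ℝ}
    (ha : a ∈ Icc t T) (hb : b ∈ Icc t T) :
    opportunityCost w t T n y a - opportunityCost w t T n y b =
      ∫ u in a..b, erlangHazard n (cumDemand w t y u) *
        ((y u - opportunityCost w t T n y u) * w (y u)) := by
  have htT := ha.1.trans ha.2
  have hsub := mem_of_mem_uIcc ha hb
  have h := ((hy.opportunityCost_absolutelyContinuous hw htT n).mono hsub).integral_deriv_eq_sub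
  rw [← neg_sub, ← h, ← intervalIntegral.integral_neg]
  refine intervalIntegral.integral_congr_ae ?_
  filter_upwards [hy.ae_deriv_opportunityCost hw htT n] with u hu hmem
  have := hsub (uIoc_subset_uIcc hmem)
  rw [uIcc_of_le htT] at this
  rw [hu this, neg_neg]

lemma integral_rate_mul_weight (hy : IsFeasible w t T y) (hw : IsDemand w B) (n : ℕ) {a b : ℝ}
    (ha : a ∈ Icc t T) (hb : b ∈ Icc t T) :
    ∫ u in a..b, w (y u) * poissonWeight n (cumDemand w t y u) =
      poissonCDF n (cumDemand w t y a) - poissonCDF n (cumDemand w t y b) := by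
  have htT := ha.1.trans ha.2
  have hsub := mem_of_mem_uIcc ha hb
  have h := ((hy.absolutelyContinuous_comp_cum hw htT (g := poissonCDF n)
    fun R => (contDiff_poissonCDF n).contDiffOn).mono hsub).integral_deriv_eq_sub
  rw [← neg_sub, ← h, ← intervalIntegral.integral_neg]
  refine intervalIntegral.integral_congr_ae ?_
  filter_upwards [hy.ae_hasDerivAt_cumDemand hw htT] with u hu hmem
  have := hsub (uIoc_subset_uIcc hmem)
  rw [uIcc_of_le htT] at this
  have h2 := (hasDerivAt_poissonCDF n _).comp u (hu this)
  have h3 : HasDerivAt (fun s => poissonCDF n (cumDemand w t y s)) _ u := h2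
  rw [h3.deriv]
  ring

lemma opportunityCost_nonneg (hy : IsFeasible w t T y) (hw : IsDemand w B) (n : ℕ) {s : ℝ}
    (hs : s ∈ Icc t T) : 0 ≤ opportunityCost w t T n y s := by
  refine div_nonneg (intervalIntegral.integral_nonneg hs.2 fun u hu => ?_)
    (poissonCDF_pos n (cum_mem (y := y) hw hs).1).le
  have huT : u ∈ Icc t T := ⟨hs.1.trans hu.1, hu.2⟩
  exact mul_nonneg (mul_nonneg (hy.nonneg u huT) (hw.nonneg _))
    (poissonWeight_nonneg n (cum_mem (y := y) hw huT).1)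

/-- If no demand remained above `c`, then `y w(y) ≤ c w(y)` and the marginal loss `c G_n(H s)` would
be at most `c (G_n(H s) - G_n(H T))`. This forces `c ≤ 0`, yet some positive threshold has demand.
-/
lemma exists_gt_opportunityCost (hy : IsFeasible w t T y) (hw : IsDemand w B) (n : ℕ) {s : ℝ}
    (hs : s ∈ Icc t T) : ∃ v, opportunityCost w t T n y s < v ∧ 0 < w v := by
  by_contra! hcon
  have hT : T ∈ Icc t T := right_mem_Icc.2 (hs.1.trans hs.2)
  set c := opportunityCost w t T n y s with hc
  have hGs := poissonCDF_pos n (cum_mem (y := y) hw hs).1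
  have hGT := poissonCDF_pos n (cum_mem (y := y) hw hT).1
  have hint : IntervalIntegrable (fun u => w (y u) * poissonWeight n (cumDemand w t y u))
      volume s T := by
    refine (hy.demand_integrable hw (hs.1.trans hs.2) hs hT).mul_continuousOn
      ((hy.comp_cum_continuousOn hw (continuous_poissonWeight n).continuousOn).mono ?_)
    exact uIcc_subset_Icc hs hT
  have h1 : marginalLoss w t T n y s ≤
      ∫ u in s..T, c * (w (y u) * poissonWeight n (cumDemand w t y u)) := by
    refine intervalIntegral.integral_mono_on hs.2 (hy.weight_integrable hw n hs hT)
      (hint.const_mul c) fun u hu => ?_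
    have huT : u ∈ Icc t T := ⟨hs.1.trans hu.1, hu.2⟩
    have hg := poissonWeight_nonneg n (cum_mem (y := y) hw huT).1
    rw [← mul_assoc]
    refine mul_le_mul_of_nonneg_right ?_ hg
    rcases le_or_gt (y u) c with h | h
    · exact mul_le_mul_of_nonneg_right h (hw.nonneg _)
    · rw [le_antisymm (hcon _ h) (hw.nonneg _)]
      simp
  rw [intervalIntegral.integral_const_mul, hy.integral_rate_mul_weight hw n hs hT] at h1
  have h2 : marginalLoss w t T n y s = c * poissonCDF n (cumDemand w t y s) := by
    rw [hc, opportunityCost, div_mul_cancel₀ _ hGs.ne']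
  have h3 : c ≤ 0 := by
    by_contra! h
    have := mul_pos h hGT
    linarith
  obtain ⟨v, hv, hwv⟩ := hw.exists_pos
  exact absurd (hcon v (h3.trans_lt hv)) hwv.not_ge

/-- An optimal threshold curve satisfies the first order conditions. -/
theorem isExtremal (hy : IsFeasible w t T y) (hw : IsDemand w B) (htT : t ≤ T) (n : ℕ)
    (hopt : ∀ z, IsFeasible w t T z → payoff w t T n z ≤ payoff w t T n y) :
    IsExtremal w t T n y (opportunityCost w t T n y) (cumDemand w t y) where
  threshold_nonneg := hy.nonneg
  rate_integrable := hy.demand_integrable hw htT (left_mem_Icc.2 htT) (right_mem_Icc.2 htT)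
  cum_eq _ := rfl
  cost_continuousOn := hy.opportunityCost_continuousOn hw htT n
  cost_horizon := by simp [opportunityCost, marginalLoss]
  cost_integrable := hy.net_integrable hw htT n
  cost_sub _ ha _ hb := hy.opportunityCost_sub hw n ha hb
  maximal := hy.maximum_principle hw n hopt
  cost_nonneg _ hs := hy.opportunityCost_nonneg hw n hs
  exists_profitable _ hs := hy.exists_gt_opportunityCost hw n hs

end IsFeasible

/-! ### Application to the revenue of the cloud provider -/

section Revenue

variable {f : ℝ → ℝ} {lam : ℝ}

/-- The arrival rate of tasks of complexity at least `v`. -/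
def taskDemand (lam : ℝ) (f : ℝ → ℝ) (v : ℝ) : ℝ := lam * (1 - taskCDF f v)

lemma taskCDF_mono (hf : IsTaskDensity f) : Monotone (taskCDF f) := fun _ _ hab =>
  setIntegral_mono_set hf.integrable.integrableOn (Filter.Eventually.of_forall hf.nonneg)
    (Iic_subset_Iic.2 hab).eventuallyLE

lemma taskCDF_nonneg (hf : IsTaskDensity f) (v : ℝ) : 0 ≤ taskCDF f v :=
  setIntegral_nonneg measurableSet_Iic fun x _ => hf.nonneg x

lemma taskCDF_le_one (hf : IsTaskDensity f) (v : ℝ) : taskCDF f v ≤ 1 := by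
  rw [← hf.integral_eq_one]
  exact setIntegral_le_integral hf.integrable (Filter.Eventually.of_forall hf.nonneg)

lemma taskCDF_zero (hf : IsTaskDensity f) : taskCDF f 0 = 0 := by
  rw [taskCDF, integral_Iic_eq_integral_Iio]
  exact setIntegral_eq_zero_of_forall_eq_zero fun x hx => hf.zero_of_neg x hx

lemma continuous_taskCDF (hf : IsTaskDensity f) : Continuous (taskCDF f) := by
  have e : taskCDF f = fun v => taskCDF f 0 + ∫ x in (0 : ℝ)..v, f x := by
    funext v
    rw [← intervalIntegral.integral_Iic_sub_Iic hf.integrable.integrableOn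
      hf.integrable.integrableOn, taskCDF, taskCDF, add_sub_cancel]
  rw [e]
  exact continuous_const.add
    (intervalIntegral.continuous_primitive (fun _ _ => hf.integrable.intervalIntegrable) 0)

lemma isDemand_taskDemand (hf : IsTaskDensity f) (hlam : 0 < lam) :
    IsDemand (taskDemand lam f) lam where
  antitone a b hab := mul_le_mul_of_nonneg_left (by linarith [taskCDF_mono hf hab]) hlam.le
  nonneg v := mul_nonneg hlam.le (sub_nonneg.2 (taskCDF_le_one hf v))
  le v := mul_le_of_le_one_right hlam.le (by linarith [taskCDF_nonneg hf v])
  exists_pos := by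
    have h : ∀ᶠ v in nhdsWithin 0 (Ioi 0), taskCDF f v < 1 :=
      ((continuous_taskCDF hf).tendsto 0 |>.mono_left nhdsWithin_le_nhds).eventually_lt_const
        (by rw [taskCDF_zero hf]; exact one_pos)
    obtain ⟨v, hv, hv0⟩ := (h.and self_mem_nhdsWithin).exists
    exact ⟨v, hv0, mul_pos hlam (sub_pos.2 hv)⟩

variable {t T : ℝ} {y : ℝ → ℝ}

lemma mul_waitDensity_eq (n : ℕ) (s : ℝ) : y s * waitDensity lam f y t (n + 1) s =
    y s * taskDemand lam f (y s) * poissonWeight n (cumDemand (taskDemand lam f) t y s) := by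
  have e : cumRate lam f y t s = cumDemand (taskDemand lam f) t y s := rfl
  rw [waitDensity, e, poissonWeight, add_tsub_cancel_right, qualRate, taskDemand]
  ring

lemma isFeasible_of_isAdmissible (hf : IsTaskDensity f) (hlam : 0 < lam) (htT : t ≤ T)
    {N : ℕ} (hN : 1 ≤ N)
    (h : IsAdmissible lam f T N t y) : IsFeasible (taskDemand lam f) t T y := by
  have hw := isDemand_taskDemand hf hlam
  refine ⟨h.nonneg, h.aemeasurable, ?_⟩
  -- The first arrival suffices: multiplying its integrand by the continuous factor `exp H` recovers
  -- `y w(y)`.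
  have h1 := h.integrable 1 (by simp [hN])
  have hc : ContinuousOn (fun s => Real.exp (cumDemand (taskDemand lam f) t y s)) (uIcc t T) := by
    refine Real.continuous_exp.comp_continuousOn ?_
    exact intervalIntegral.continuousOn_primitive_interval'
      (intervalIntegrable_demand hw htT h.aemeasurable) left_mem_uIcc
  refine (h1.mul_continuousOn hc).congr fun s _ => ?_
  have := mul_waitDensity_eq (lam := lam) (f := f) (t := t) (y := y) 0 s
  simp only [zero_add] at this
  simp only [this, poissonWeight, pow_zero, Nat.factorial_zero, Nat.cast_one, div_one, mul_one]
  rw [mul_assoc, ← Real.exp_add, neg_add_cancel, Real.exp_zero, mul_one]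

lemma IsFeasible.isAdmissible (hf : IsTaskDensity f) (hlam : 0 < lam) (htT : t ≤ T) (N : ℕ)
    (h : IsFeasible (taskDemand lam f) t T y) : IsAdmissible lam f T N t y := by
  refine ⟨h.nonneg, h.aemeasurable, fun n hn => ?_⟩
  obtain ⟨n, rfl⟩ : ∃ k, n = k + 1 := ⟨n - 1, by have := (Finset.mem_Icc.1 hn).1; omega⟩
  simp only [mul_waitDensity_eq]
  exact h.weight_integrable (isDemand_taskDemand hf hlam) n (left_mem_Icc.2 htT)
    (right_mem_Icc.2 htT)

/-- The `(k + 1)`-st arrival density is the rate times `g_k(H)`, and these weights add up to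
`G_n(H)`. Since `q > 0` in the application, optimality passes to `payoff` whatever `κ` is. -/
lemma revenue_eq (hf : IsTaskDensity f) (hlam : 0 < lam) (htT : t ≤ T) (q κ : ℝ) (n : ℕ)
    (h : IsFeasible (taskDemand lam f) t T y) :
    revenue q lam f T κ (n + 1) t y = q * payoff (taskDemand lam f) t T n y + κ := by
  have hw := isDemand_taskDemand hf hlam
  rw [revenue, payoff, ← Finset.mul_sum]
  congr 2
  have hshift : ∀ F : ℕ → ℝ, ∑ k ∈ Finset.Icc 1 (n + 1), F k =
      ∑ k ∈ Finset.range (n + 1), F (k + 1) := fun F => by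
    rw [Finset.range_eq_Ico, Finset.sum_Ico_add' F 0 (n + 1) 1]
    rfl
  rw [hshift]
  simp only [poissonCDF, Finset.mul_sum, mul_waitDensity_eq]
  rw [intervalIntegral.integral_finsetSum fun k _ =>
    h.weight_integrable hw k (left_mem_Icc.2 htT) (right_mem_Icc.2 htT)]

lemma IsOptimalThreshold.isExtremal (hf : IsTaskDensity f) (hlam : 0 < lam) (htT : t ≤ T)
    {q κ : ℝ} (hq : 0 < q) {n : ℕ} (h : IsOptimalThreshold q lam f T κ (n + 1) t y) :
    IsExtremal (taskDemand lam f) t T n y (opportunityCost (taskDemand lam f) t T n y)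
      (cumDemand (taskDemand lam f) t y) := by
  have hy := isFeasible_of_isAdmissible hf hlam htT (by omega) h.1
  refine hy.isExtremal (isDemand_taskDemand hf hlam) htT n fun z hz => ?_
  have h1 := h.2 z (hz.isAdmissible hf hlam htT _)
  rw [revenue_eq hf hlam htT q κ n hz, revenue_eq hf hlam htT q κ n hy] at h1
  exact le_of_mul_le_mul_left (by linarith) hq

end Revenue

/-- An inequality between continuous functions on an interval that holds almost everywhere holds
everywhere. -/
lemma le_on_Icc_of_ae_le {g h : ℝ → ℝ} {a b : ℝ} (hab : a < b)
    (hae : ∀ᵐ s ∂(volume.restrict (Icc a b)), g s ≤ h s) (hg : ContinuousOn g (Icc a b))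
    (hh : ContinuousOn h (Icc a b)) : ∀ s ∈ Icc a b, g s ≤ h s := by
  intro s hs
  -- The inequality is encoded as the equation `min g h = g` between continuous functions.
  have := Measure.eqOn_Icc_of_ae_eq volume hab.ne (f := fun s => min (g s) (h s)) (g := g)
    (hae.mono fun s hs => min_eq_left hs) (hg.inf hh) hg hs
  exact min_eq_left_iff.1 this

end CloudPricing

end

theorem theorem3
    (q : ℝ) (hq0 : 0 < q) (hq1 : q ≤ 1)
    (lam : ℝ) (hlam : 0 < lam)
    (f : ℝ → ℝ) (hf : CloudPricing.IsTaskDensity f)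
    (hsupp : {x : ℝ | 0 < f x}.OrdConnected)
    (hvirt : MonotoneOn (CloudPricing.virtualValuation f) {x : ℝ | 0 < f x})
    (T : ℝ) (S : ℝ → ℝ) (κ : ℕ → ℝ)
    (t : ℝ) (ht0 : 0 ≤ t) (htT : t < T)
    (M N : ℕ) (hN : 1 ≤ N) (hNM : N ≤ M)
    (yM yN : ℝ → ℝ)
    (hyM : CloudPricing.IsOptimalThreshold q lam f T (κ M) M t yM)
    (hyN : CloudPricing.IsOptimalThreshold q lam f T (κ N) N t yN) :
    (∀ᵐ s ∂(MeasureTheory.volume.restrict (Set.Icc t T)),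
      yM s ≤ yN s ∧ CloudPricing.price q S yM s ≤ CloudPricing.price q S yN s) ∧
    (ContinuousOn yM (Set.Icc t T) → ContinuousOn yN (Set.Icc t T) →
      ∀ s ∈ Set.Icc t T,
        yM s ≤ yN s ∧ CloudPricing.price q S yM s ≤ CloudPricing.price q S yN s) := by
  have hprice : ∀ s, yM s ≤ yN s →
      yM s ≤ yN s ∧ CloudPricing.price q S yM s ≤ CloudPricing.price q S yN s := fun s h =>
    ⟨h, add_le_add_left (mul_le_mul_of_nonneg_left h hq0.le) _⟩
  -- With `n + 1` machines a task is served when at most `n` qualifying tasks came before it, whence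
  -- the shift.
  obtain ⟨n, rfl⟩ : ∃ k, N = k + 1 := ⟨N - 1, by omega⟩
  obtain ⟨m, rfl⟩ : ∃ k, M = k + 1 := ⟨M - 1, by omega⟩
  have hw := CloudPricing.isDemand_taskDemand hf hlam
  have hae : ∀ᵐ s ∂(MeasureTheory.volume.restrict (Set.Icc t T)), yM s ≤ yN s := by
    rw [MeasureTheory.ae_restrict_iff' measurableSet_Icc]
    exact (hyN.isExtremal hf hlam htT.le hq0).threshold_le (hyM.isExtremal hf hlam htT.le hq0)
      (by omega) hw.nonneg hw.le hw.antitone htT.le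
  exact ⟨hae.mono hprice, fun hcM hcN s hs =>
    hprice s (CloudPricing.le_on_Icc_of_ae_le htT hae hcM hcN s hs)⟩
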